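/- Let $C\subset\mathbb{R}^n$ be an uncountable compact set (for example a box $[a,b]^n$ with $a<b$, $n\ge 1$), and let $d_0,d_1,d_2,\dots$ be any dense sequence of points of $C$ (for example, an enumeration of the rational points of the box). For a continuous function $f:C\to\mathbb{R}$ let $A_f\subset\mathbb{N}$ be the set of codes of the pairs $(i,r)$, where $i\in\mathbb{N}$ and $r$ is a rational number with $r<f(d_i)$; thus an oracle for $A_f$ gives the values of $f$ at the points $d_i$ (to any precision) and no other information about $f$. Write $\Phi_e^{A}$ for the partial function $\mathbb{N}\to\mathbb{N}$ computed by the oracle program $e$ with oracle $A$. Theorem. Finding a global minimum of a continuous function on $C$ is not limit computable: there is no oracle program $e$ such that for every continuous function $f:C\to\mathbb{R}$ the function $\Phi_e^{A_f}$ is total and the computed sequence of points $$x_s=d_{\Phi_e^{A_f}(s)},\qquad s=0,1,2,\dots,$$ converges to a global minimum of $f$, that is, to a point $x^*\in C$ with $f(x^*)\le f(x)$ for all $x\in C$. -/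

import Mathlib

open Filter Topology

/-- Programs for machines with an oracle: the usual codes for partial recursive functions of
natural numbers, together with an instruction that queries the oracle. -/
inductive OracleProgram : Type
  | zero : OracleProgram
  | succ : OracleProgram
  | left : OracleProgram
  | right : OracleProgram
  | oracle : OracleProgram
  | pair : OracleProgram → OracleProgram → OracleProgram
  | comp : OracleProgram → OracleProgram → OracleProgram
  | prec : OracleProgram → OracleProgram → OracleProgram
  | rfind : OracleProgram → OracleProgram

open Classical in
/-- The characteristic function of a set of natural numbers. -/
noncomputable def charFn (A : Set ℕ) (m : ℕ) : ℕ := if m ∈ A then 1 else 0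

/-- `e.eval A` is the Turing functional `Φ_e^A`: the partial function computed by the program `e`
with the characteristic function of `A` as its oracle. -/
noncomputable def OracleProgram.eval (A : Set ℕ) : OracleProgram → ℕ →. ℕ
  | zero => fun _ => Part.some 0
  | succ => fun m => Part.some (m + 1)
  | left => fun m => Part.some m.unpair.1
  | right => fun m => Part.some m.unpair.2
  | oracle => fun m => Part.some (charFn A m)
  | pair p q => fun m => Nat.pair <$> p.eval A m <*> q.eval A m
  | comp p q => fun m => q.eval A m >>= p.eval A
  | prec p q => fun m =>
      m.unpair.2.rec (p.eval A m.unpair.1) fun y ih => do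
        let i ← ih
        q.eval A (Nat.pair m.unpair.1 (Nat.pair y i))
  | rfind p => fun m => Nat.rfind fun k => (fun j => j = 0) <$> p.eval A (Nat.pair m k)

/-- The functions computed by programs with oracle `A` are exactly the partial functions that are
recursive in the characteristic function of `A`, in the sense of Mathlib. -/
theorem OracleProgram.exists_eval_eq_iff (A : Set ℕ) (θ : ℕ →. ℕ) :
    (∃ e : OracleProgram, e.eval A = θ) ↔
      Nat.RecursiveIn {fun m => Part.some (charFn A m)} θ := by
  constructor
  · rintro ⟨e, rfl⟩
    induction e with
    | zero => exact .zero
    | succ => exact .succ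
    | left => exact .left
    | right => exact .right
    | oracle => exact .oracle _ rfl
    | pair p q hp hq => exact .pair hp hq
    | comp p q hp hq => exact .comp hp hq
    | prec p q hp hq => exact .prec hp hq
    | rfind p hp => exact .rfind hp
  · intro h
    induction h with
    | zero => exact ⟨.zero, rfl⟩
    | succ => exact ⟨.succ, rfl⟩
    | left => exact ⟨.left, rfl⟩
    | right => exact ⟨.right, rfl⟩
    | oracle g hg => exact ⟨.oracle, (Set.mem_singleton_iff.1 hg).symm⟩
    | pair _ _ hp hq =>
      obtain ⟨p, rfl⟩ := hp
      obtain ⟨q, rfl⟩ := hq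
      exact ⟨.pair p q, rfl⟩
    | comp _ _ hp hq =>
      obtain ⟨p, rfl⟩ := hp
      obtain ⟨q, rfl⟩ := hq
      exact ⟨.comp p q, rfl⟩
    | prec _ _ hp hq =>
      obtain ⟨p, rfl⟩ := hp
      obtain ⟨q, rfl⟩ := hq
      exact ⟨.prec p q, rfl⟩
    | rfind _ hp =>
      obtain ⟨p, rfl⟩ := hp
      exact ⟨.rfind p, rfl⟩

/-- The values of `f` at the points `d 0, d 1, …` as a set of natural numbers: the set of all
(codes of) pairs of an index `i` and a rational number `r = (a - b) / (c + 1)` with `r < f (d i)`.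
That is, the sequence of the Dedekind cuts of the reals `f (d i)`. -/
def valueOracle {X : Type*} [TopologicalSpace X] (d : ℕ → X) (f : C(X, ℝ)) : Set ℕ :=
  {m | ∃ i a b c : ℕ, m = Nat.pair i (Nat.pair a (Nat.pair b c)) ∧
    ((a : ℝ) - (b : ℝ)) / ((c : ℝ) + 1) < f (d i)}

/-- Finding a global minimum of a continuous function on `X` is limit computable: a single program,
which knows the function `f` only through its values at the points `d 0, d 1, …`, computes for every
continuous `f` a sequence of points (named by their indices in `d`) whose limit exists and is
a global minimum of `f`. -/
def GlobalMinLimitComputable {X : Type*} [TopologicalSpace X] (d : ℕ → X) : Prop :=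
  ∃ e : OracleProgram, ∀ f : C(X, ℝ),
    ∃ i : ℕ → ℕ, (∀ s, e.eval (valueOracle d f) s = Part.some (i s)) ∧
      ∃ x : X, (∀ y : X, f x ≤ f y) ∧ Tendsto (fun s => d (i s)) atTop (𝓝 x)

/-! An adversary defeats the program. Since `C` is uncountable, two points z, w are not among the
d_i, and they have neighbourhoods U, V with disjoint closures. Starting from 0, f is lowered
alternately near z and near w, so that each in turn becomes the strictly deeper well and the program
must output a point of U, respectively V. Each such output depends on finitely many values of f
(`eventually_mem_eval`), which are then frozen; lowering stays possible because z and w are never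
sampled (`TwoWells.exists_next`). The changes shrink geometrically, so a continuous limit exists,
and on it the outputs visit both U and V infinitely often: they cannot converge. -/

/-- Use principle: a halting oracle computation queries only finitely many numbers. -/
theorem OracleProgram.eventually_mem_eval {A : Set ℕ} (e : OracleProgram) {m v : ℕ}
    (h : v ∈ e.eval A m) :
    ∀ᶠ M : ℕ in atTop, ∀ B : Set ℕ, (∀ q < M, charFn B q = charFn A q) → v ∈ e.eval B m := by
  induction e generalizing m v with
  | zero => exact .of_forall fun _ _ _ => h
  | succ => exact .of_forall fun _ _ _ => h
  | left => exact .of_forall fun _ _ _ => h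
  | right => exact .of_forall fun _ _ _ => h
  | oracle =>
    filter_upwards [eventually_gt_atTop m] with M hM B hB
    simpa only [OracleProgram.eval, hB m hM] using h
  | pair p q hp hq =>
    simp only [OracleProgram.eval, Seq.seq, Part.map_eq_map, Part.mem_bind_iff, Part.mem_map_iff]
      at h ⊢
    obtain ⟨_, ⟨a, ha, rfl⟩, b, hb, rfl⟩ := h
    filter_upwards [hp ha, hq hb] with M h₁ h₂ B hB
    exact ⟨_, ⟨a, h₁ B hB, rfl⟩, b, h₂ B hB, rfl⟩
  | comp p q hp hq =>
    obtain ⟨a, ha, hv⟩ := Part.mem_bind_iff.1 h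
    filter_upwards [hq ha, hp hv] with M h₁ h₂ B hB
    exact Part.mem_bind_iff.2 ⟨a, h₁ B hB, h₂ B hB⟩
  | prec p q hp hq =>
    simp only [OracleProgram.eval] at h ⊢
    generalize m.unpair.2 = y at h ⊢
    induction y generalizing v with
    | zero => exact hp h
    | succ y ih =>
      simp only [Part.bind_eq_bind, Part.mem_bind_iff] at h ⊢
      obtain ⟨a, ha, hv⟩ := h
      filter_upwards [ih ha, hq hv] with M h₁ h₂ B hB
      exact ⟨a, h₁ B hB, h₂ B hB⟩
  | rfind p hp =>
    obtain ⟨h₀, hlt⟩ := Nat.mem_rfind.1 h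
    obtain ⟨a, ha, hav⟩ := (Part.mem_map_iff _).1 h₀
    have hlt' : ∀ᶠ M : ℕ in atTop, ∀ k ∈ Finset.range v, ∀ B : Set ℕ,
        (∀ q < M, charFn B q = charFn A q) →
          ∃ a ∈ p.eval B (Nat.pair m k), decide (a = 0) = false := by
      rw [eventually_all_finset]
      intro k hk
      obtain ⟨b, hb, hbk⟩ := (Part.mem_map_iff _).1 (hlt (Finset.mem_range.1 hk))
      filter_upwards [hp hb] with M h₁ B hB
      exact ⟨b, h₁ B hB, hbk⟩
    filter_upwards [hp ha, hlt'] with M h₁ h₂ B hB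
    exact Nat.mem_rfind.2 ⟨(Part.mem_map_iff _).2 ⟨a, h₁ B hB, hav⟩,
      fun {k} hk => (Part.mem_map_iff _).2 (h₂ k (Finset.mem_range.2 hk) B hB)⟩

/-- A code `Nat.pair i t` is at least `i`, so a query below `M` concerns only values at points with
index below `M`. -/
theorem charFn_valueOracle_congr {X : Type*} [TopologicalSpace X] {d : ℕ → X} {f g : C(X, ℝ)}
    {M : ℕ} (h : ∀ i < M, g (d i) = f (d i)) {q : ℕ} (hq : q < M) :
    charFn (valueOracle d g) q = charFn (valueOracle d f) q := by
  have : q ∈ valueOracle d g ↔ q ∈ valueOracle d f := by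
    have key : ∀ i t : ℕ, q = Nat.pair i t → g (d i) = f (d i) := fun i t hi =>
      h i ((Nat.left_le_pair i t).trans_lt (hi ▸ hq))
    constructor <;> rintro ⟨i, a, b, c, hi, hlt⟩ <;> refine ⟨i, a, b, c, hi, ?_⟩
    · rwa [← key i _ hi]
    · rwa [key i _ hi]
  unfold charFn
  congr 1
  exact propext this

/-- A halting computation with the values of `f` as its oracle uses only finitely many values. -/
theorem OracleProgram.exists_forall_mem_eval_valueOracle {X : Type*} [TopologicalSpace X]
    {d : ℕ → X} {f : C(X, ℝ)} (e : OracleProgram) {m v : ℕ} (h : v ∈ e.eval (valueOracle d f) m)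
    (N : ℕ) :
    ∃ M ≥ N, ∀ g : C(X, ℝ), (∀ i < M, g (d i) = f (d i)) → v ∈ e.eval (valueOracle d g) m := by
  obtain ⟨M, hM, hNM⟩ := ((e.eventually_mem_eval h).and (eventually_ge_atTop N)).exists
  exact ⟨M, hNM, fun g hg => hM _ fun q hq => charFn_valueOracle_congr hg hq⟩

/-- The program `e`, given the values of `f`, outputs at some stage `s ≥ k` an index of a point of
`U`, and it does so for every function with the same values as `f` at `d 0, …, d (M - 1)`. -/
def OracleProgram.ForcesVisit {X : Type*} [TopologicalSpace X] (d : ℕ → X) (e : OracleProgram)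
    (U : Set X) (k M : ℕ) (f : C(X, ℝ)) : Prop :=
  ∃ s ≥ k, ∃ v, d v ∈ U ∧
    ∀ g : C(X, ℝ), (∀ i < M, g (d i) = f (d i)) → v ∈ e.eval (valueOracle d g) s

/-- `f` has wells at `z` in `U` and at `w` in `V`, the latter being the deeper one, by at most
`2 * δ`. -/
structure TwoWells {X : Type*} [TopologicalSpace X] (U V : Set X) (z w : X) (δ : ℝ)
    (f : C(X, ℝ)) : Prop where
  le_of_notMem_right : ∀ x ∉ V, f z ≤ f x
  le_of_notMem_left : ∀ x ∉ U, f w ≤ f x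
  le : f w ≤ f z
  le_add : f z ≤ f w + 2 * δ

/-- The well at `z` can be made the deeper one without changing finitely many prescribed values,
after which a program for global minima has to output a point near `z`. -/
theorem TwoWells.exists_next {X : Type*} [TopologicalSpace X] [CompactSpace X] [T2Space X]
    {d : ℕ → X} {e : OracleProgram}
    (he : ∀ f : C(X, ℝ), ∃ i : ℕ → ℕ, (∀ s, e.eval (valueOracle d f) s = Part.some (i s)) ∧
      ∃ x : X, (∀ y : X, f x ≤ f y) ∧ Tendsto (fun s => d (i s)) atTop (𝓝 x))
    {U V : Set X} {z w : X} {δ : ℝ} {f : C(X, ℝ)} (hf : TwoWells U V z w δ f) (hδ : 0 < δ)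
    (hU : IsOpen U) (hz : z ∈ U) (hw : w ∉ U) (hzd : z ∉ Set.range d) (k N : ℕ) :
    ∃ f' : C(X, ℝ), ∃ N' ≥ N, TwoWells V U w z (δ / 2) f' ∧ dist f f' ≤ 3 * δ ∧
      (∀ i < N, f' (d i) = f (d i)) ∧ e.ForcesVisit d U k N' f' := by
  -- Urysohn bump at `z`, vanishing off `U` and at the frozen points; `z` is not one of them by
  -- `hzd`.
  obtain ⟨b, hb0, hb1, hb⟩ := exists_continuous_zero_one_of_isClosed
    (s := Uᶜ ∪ d '' Set.Iio N) (t := {z})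
    (hU.isClosed_compl.union ((Set.finite_Iio N).image d).isClosed) isClosed_singleton (by
      rw [Set.disjoint_singleton_right]
      rintro (h | ⟨i, -, h⟩)
      exacts [h hz, hzd ⟨i, h⟩])
  have hbU : ∀ x ∉ U, b x = 0 := fun x hx => hb0 (.inl hx)
  have hbz : b z = 1 := hb1 rfl
  have hle := hf.le
  have hle' := hf.le_add
  -- This depth puts the new well at `f w - δ`, strictly below the other by `δ = 2 * (δ / 2)`;
  -- moreover `c ≤ 3 * δ`.
  set c : ℝ := f z - f w + δ with hc
  have hc0 : 0 ≤ c := by linarith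
  set f' : C(X, ℝ) := f - c • b with hf'
  have hf'x : ∀ x, f' x = f x - c * b x := fun x => by simp [hf']
  have hf'z : f' z = f w - δ := by rw [hf'x, hbz, hc]; ring
  have hf'U : ∀ x ∉ U, f' x = f x := fun x hx => by rw [hf'x, hbU x hx]; ring
  have hwells : TwoWells V U w z (δ / 2) f' := by
    refine ⟨fun x hx => ?_, fun x hx => ?_, ?_, ?_⟩
    · rw [hf'U x hx, hf'U w hw]
      exact hf.le_of_notMem_left x hx
    · have h₁ := hf.le_of_notMem_right x hx
      have h₂ := mul_le_of_le_one_right hc0 (hb x).2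
      rw [hf'x x, hf'z]
      linarith
    · rw [hf'z, hf'U w hw]
      linarith
    · rw [hf'z, hf'U w hw]
      linarith
  obtain ⟨i, hi, y, hy, hlim⟩ := he f'
  have hyU : y ∈ U := by
    by_contra h
    have h₁ := hwells.le_of_notMem_right y h
    have h₂ := hy z
    rw [hf'U w hw] at h₁
    linarith
  obtain ⟨s, hsU, hsk⟩ :=
    ((hlim.eventually_mem (hU.mem_nhds hyU)).and (eventually_ge_atTop k)).exists
  obtain ⟨N', hN', hforce⟩ := e.exists_forall_mem_eval_valueOracle
    (d := d) (f := f') (m := s) (v := i s) (by rw [hi]; exact Part.mem_some _) N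
  refine ⟨f', N', hN', hwells, ?_, fun j hj => ?_, s, hsk, i s, hsU, hforce⟩
  · rw [ContinuousMap.dist_le (by positivity)]
    intro x
    rw [hf'x, Real.dist_eq, sub_sub_cancel, abs_of_nonneg (mul_nonneg hc0 (hb x).1)]
    have := mul_le_of_le_one_right hc0 (hb x).2
    linarith
  · rw [hf'x, hb0 (.inr ⟨j, hj, rfl⟩)]
    simp

/-- On a compact Hausdorff space, global minima are not limit computable from the values at points
`d 0, d 1, …` that miss at least two points. -/
theorem not_globalMinLimitComputable {X : Type*} [TopologicalSpace X] [CompactSpace X] [T2Space X]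
    (d : ℕ → X) (h : (Set.range d)ᶜ.Nontrivial) : ¬ GlobalMinLimitComputable d := by
  rintro ⟨e, he⟩
  obtain ⟨z, hz, w, hw, hzw⟩ := h
  obtain ⟨U, hzU, hU, V, hwV, hV, hUV⟩ := exists_open_nhds_disjoint_closure hzw
  have hwU : w ∉ U := fun h => Set.disjoint_left.1 hUV (subset_closure h) (subset_closure hwV)
  have hzV : z ∉ V := fun h => Set.disjoint_left.1 hUV (subset_closure hzU) (subset_closure h)
  -- A state consists of a function and of the number of its values that are already fixed.
  let Inv (k : ℕ) (σ : C(X, ℝ) × ℕ) : Prop := TwoWells U V z w ((1 / 4) ^ k) σ.1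
  -- One round deepens `z`, then `w`: the gap parameter is halved twice, hence `1 / 4`, and the
  -- total change is at most 3δ + 3δ/2 ≤ 6δ.
  have step : ∀ k (σ : {σ : C(X, ℝ) × ℕ // Inv k σ}), ∃ τ : {τ : C(X, ℝ) × ℕ // Inv (k + 1) τ},
      ∃ M : ℕ, ∃ g : C(X, ℝ), dist σ.1.1 τ.1.1 ≤ 6 * (1 / 4) ^ k ∧ σ.1.2 ≤ M ∧ M ≤ τ.1.2 ∧
        (∀ i < σ.1.2, τ.1.1 (d i) = σ.1.1 (d i)) ∧ (∀ i < M, τ.1.1 (d i) = g (d i)) ∧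
        e.ForcesVisit d U k M g ∧ e.ForcesVisit d V k τ.1.2 τ.1.1 := by
    rintro k ⟨⟨f, N⟩, hf⟩
    have hδ : (0 : ℝ) < (1 / 4) ^ k := by positivity
    obtain ⟨g, M, hM, hg, hfg, hgN, hgU⟩ := hf.exists_next he hδ hU hzU hwU hz k N
    obtain ⟨f', N', hN', hf', hgf', hf'M, hf'V⟩ :=
      hg.exists_next he (half_pos hδ) hV hwV hzV hw k M
    refine ⟨⟨(f', N'), ?_⟩, M, g, ?_, hM, hN', fun i hi => ?_, hf'M, hgU, hf'V⟩
    · convert hf' using 1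
      rw [pow_succ]
      ring
    · have := dist_triangle f g f'
      dsimp only at hfg ⊢
      linarith
    · exact (hf'M i (hi.trans_le hM)).trans (hgN i hi)
  choose next M g hdist hNM hMN hfix hg hvisU hvisV using step
  let σ (k : ℕ) : {σ : C(X, ℝ) × ℕ // Inv k σ} :=
    Nat.rec ⟨(0, 0), ⟨by simp, by simp, by simp, by simp⟩⟩ next k
  obtain ⟨f, hf⟩ := cauchySeq_tendsto_of_complete
    (cauchySeq_of_le_geometric (1 / 4) 6 (by norm_num) fun k => hdist k (σ k))
  -- Frozen values never change again, so the limit inherits them.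
  have hfσ : ∀ k, ∀ i < (σ k).1.2, f (d i) = (σ k).1.1 (d i) := by
    intro k i hi
    have hconst : ∀ j ≥ k, i < (σ j).1.2 ∧ (σ j).1.1 (d i) = (σ k).1.1 (d i) := by
      intro j hj
      induction j, hj using Nat.le_induction with
      | base => exact ⟨hi, rfl⟩
      | succ j _ ih =>
        exact ⟨ih.1.trans_le ((hNM j (σ j)).trans (hMN j (σ j))),
          (hfix j (σ j) i ih.1).trans ih.2⟩
    refine tendsto_nhds_unique
      (((continuous_eval_const (F := C(X, ℝ)) (d i)).tendsto f).comp hf) ?_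
    exact tendsto_const_nhds.congr'
      ((eventually_ge_atTop k).mono fun j hj => (hconst j hj).2.symm)
  -- Only convergence on the limit function is used; minimality was needed at the finite stages.
  obtain ⟨i, hi, x, -, hlim⟩ := he f
  have visits : ∀ {W : Set X} {k L : ℕ} {g' : C(X, ℝ)}, e.ForcesVisit d W k L g' →
      (∀ j < L, f (d j) = g' (d j)) → ∃ s ≥ k, d (i s) ∈ W := by
    rintro W k L g' ⟨s, hs, v, hv, hforce⟩ hfg
    have := hforce f hfg
    rw [hi, Part.mem_some_iff] at this
    exact ⟨s, hs, this ▸ hv⟩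
  have hxU : x ∈ closure U := mem_closure_of_frequently_of_tendsto
    (frequently_atTop.2 fun k => visits (hvisU k (σ k)) fun j hj =>
      (hfσ (k + 1) j (hj.trans_le (hMN k (σ k)))).trans (hg k (σ k) j hj)) hlim
  have hxV : x ∈ closure V := mem_closure_of_frequently_of_tendsto
    (frequently_atTop.2 fun k => visits (hvisV k (σ k)) (hfσ (k + 1))) hlim
  exact Set.disjoint_left.1 hUV hxU hxV

theorem mainTheorem1 {n : ℕ} (C : Set (EuclideanSpace ℝ (Fin n))) (hC : IsCompact C)
    (hunc : ¬ C.Countable) (d : ℕ → C) (hd : DenseRange d) :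
    ¬ GlobalMinLimitComputable d := by
  have := isCompact_iff_compactSpace.1 hC
  apply not_globalMinLimitComputable
  -- If at most one point were missed by `d`, then `C` would be countable.
  by_contra h
  rw [Set.not_nontrivial_iff] at h
  have huniv := (Set.countable_range d).union h.countable
  rw [Set.union_compl_self, Set.countable_univ_iff] at huniv
  exact hunc (Set.countable_coe_iff.1 huniv)
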